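/- Let $X$ be a complex separable Banach space and let $T$ be a bounded linear operator on $X$. Suppose that the eigenvectors of $T$ associated to eigenvalues of modulus $1$ are perfectly spanning, that is: there exists a continuous Borel probability measure $\sigma$ on the unit circle $\mathbb{T}=\{\lambda\in\mathbb{C} : |\lambda|=1\}$ (continuous means $\sigma(\{\lambda\})=0$ for every $\lambda\in\mathbb{T}$) such that for every $\sigma$-measurable set $A\subseteq\mathbb{T}$ with $\sigma(A)=1$, the linear span of $\bigcup_{\lambda\in A}\ker(T-\lambda)$ is dense in $X$. Then $T$ is frequently hypercyclic, that is: there exists a vector $x\in X$ such that for every non-empty open set $U\subseteq X$, the set $\{n\ge 0 : T^n x\in U\}$ has positive lower density, where the lower density of a set $D\subseteq\mathbb{N}$ is $\liminf_{N\to\infty}\frac1N\#\{n\in D : 0\le n<N\}$. -/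

import Mathlib

open Filter Topology MeasureTheory

/-- The lower density `liminf_{N → ∞} #(A ∩ {0, …, N - 1}) / N` of a set of natural numbers. -/
noncomputable def lowerDensity (A : Set ℕ) : ℝ :=
  liminf (fun N : ℕ => ((A ∩ Set.Iio N).ncard : ℝ) / (N : ℝ)) atTop

/-- `T` is frequently hypercyclic: there is a vector whose orbit visits every non-empty open set
along a set of times of positive lower density. -/
def IsFrequentlyHypercyclic {X : Type*} [NormedAddCommGroup X] [NormedSpace ℂ X]
    (T : X →L[ℂ] X) : Prop :=
  ∃ x : X, ∀ U : Set X, IsOpen U → U.Nonempty →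
    0 < lowerDensity {n : ℕ | (T ^ n) x ∈ U}

/-- The eigenvectors of `T` associated to unimodular eigenvalues are perfectly spanning with respect
to the Borel measure `σ` on the unit circle: for every `σ`-measurable set `A` of `σ`-measure `1`,
the linear span of the union of the `ker (T - z)`, `z ∈ A`, is dense. -/
def IsPerfectlySpanningFor {X : Type*} [NormedAddCommGroup X] [NormedSpace ℂ X]
    (T : X →L[ℂ] X) (σ : Measure (Metric.sphere (0 : ℂ) 1)) : Prop :=
  ∀ A : Set (Metric.sphere (0 : ℂ) 1), NullMeasurableSet A σ → σ A = 1 →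
    Dense (Submodule.span ℂ
      (⋃ z ∈ A, (Module.End.eigenspace (T : X →ₗ[ℂ] X) (z : ℂ) : Set X)) : Set X)

/-- `T` has a perfectly spanning set of eigenvectors associated to unimodular eigenvalues: they are
perfectly spanning with respect to some continuous (every point has measure `0`) Borel probability measure on
the unit circle. -/
def HasPerfectlySpanningUnimodularEigenvectors {X : Type*} [NormedAddCommGroup X]
    [NormedSpace ℂ X] (T : X →L[ℂ] X) : Prop :=
  ∃ σ : Measure (Metric.sphere (0 : ℂ) 1),
    IsProbabilityMeasure σ ∧ NullSingletonClass σ ∧ IsPerfectlySpanningFor T σ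

/-!
The frequently hypercyclic vector is a series `x = ∑ wₖ` of linear combinations of eigenvectors with
unimodular eigenvalues. No invariant measure and no ergodic theorem is needed.

*Perfect spanning is used only once.* Discarding countably many eigenvalues, every remaining
eigenvector is a limit of eigenvectors for infinitely many different eigenvalues; since `σ` has no
atoms, such vectors still span a dense subspace (`dense_span_eigenvectorLimits`).

*Blocks that are rarely large.* If `y` is such a limit, let `b` be the average of `N` eigenvectors
close to `y`, with distinct eigenvalues `zⱼ`. Then `b` is close to `y`, but
`T ^ n b ≈ (N⁻¹ ∑ zⱼ ^ n) y`, and by orthogonality of characters the mean of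
`‖N⁻¹ ∑ zⱼ ^ n‖ ^ 2` over a long window of times is about `1 / N`. So `T ^ n b` is small except for a
set of times of small upper Banach density. The vectors that can be approximated by such blocks form
a closed subspace, hence they are all of `X` (`exists_block`).

*Adding a block* (`exists_next_block`). Given a combination `v` of unimodular eigenvectors and a
target `u`, take a block `b` close to `u - v` and put `w = T ^ s b`. The times `s` at which
`T ^ s v ≈ v` are syndetic, and a concatenation argument shows that `s` can be chosen among them such
that `T ^ n w` is rarely large in *every* initial segment of times. As `s` is almost a period of `v`,
`T ^ n (v + w) ≈ u` whenever `n + s` is an almost period of `v` and `b`, which happens syndetically.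

In the series, the density of the exceptional times of `wₗ` is taken much smaller than
the frequencies with which the earlier partial sums visit their targets, so most of these visits
survive for `x`.
-/

open Filter Topology MeasureTheory

/-! ### Counting visits in windows of times -/

open Classical in
/-- The number of elements of `E` in the window `[m, m + L)`. -/
noncomputable def visits (E : Set ℕ) (m L : ℕ) : ℕ :=
  ((Finset.Ico m (m + L)).filter (· ∈ E)).card

lemma visits_mono {E F : Set ℕ} (h : E ⊆ F) (m L : ℕ) : visits E m L ≤ visits F m L := by
  classical
  exact Finset.card_le_card fun n hn => by
    rw [Finset.mem_filter] at hn ⊢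
    exact ⟨hn.1, h hn.2⟩

lemma visits_union_le (E F : Set ℕ) (m L : ℕ) :
    visits (E ∪ F) m L ≤ visits E m L + visits F m L := by
  classical
  refine le_trans (Finset.card_le_card ?_) (Finset.card_union_le _ _)
  intro n hn
  simp only [Finset.mem_filter, Finset.mem_union, Set.mem_union] at hn ⊢
  tauto

lemma visits_le (E : Set ℕ) (m L : ℕ) : visits E m L ≤ L := by
  classical
  exact (Finset.card_filter_le _ _).trans (by simp)

lemma visits_append (E : Set ℕ) (m K L : ℕ) :
    visits E m (K + L) = visits E m K + visits E (m + K) L := by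
  classical
  unfold visits
  rw [← Finset.card_union_of_disjoint]
  · congr 1
    ext n
    simp only [Finset.mem_filter, Finset.mem_union, Finset.mem_Ico]
    constructor
    · rintro ⟨h, hE⟩
      by_cases hn : n < m + K
      · exact Or.inl ⟨⟨h.1, hn⟩, hE⟩
      · exact Or.inr ⟨⟨by omega, by omega⟩, hE⟩
    · rintro (⟨h, hE⟩ | ⟨h, hE⟩)
      · exact ⟨⟨by omega, by omega⟩, hE⟩
      · exact ⟨⟨by omega, by omega⟩, hE⟩
  · rw [Finset.disjoint_left]
    intro n h1 h2
    simp only [Finset.mem_filter, Finset.mem_Ico] at h1 h2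
    omega

lemma visits_preimage_add (E : Set ℕ) (s L : ℕ) :
    visits {n | n + s ∈ E} 0 L = visits E s L := by
  classical
  unfold visits
  refine Finset.card_bij (fun n _ => n + s) ?_ ?_ ?_
  · intro n hn
    simp only [Finset.mem_filter, Finset.mem_Ico, Set.mem_ofPred_eq] at hn ⊢
    exact ⟨by omega, hn.2⟩
  · intro a _ b _ h
    exact Nat.add_right_cancel h
  · intro n hn
    simp only [Finset.mem_filter, Finset.mem_Ico] at hn
    refine ⟨n - s, ?_, by omega⟩
    simp only [Finset.mem_filter, Finset.mem_Ico, Set.mem_ofPred_eq]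
    rw [Nat.sub_add_cancel hn.1.1]
    exact ⟨by omega, hn.2⟩

lemma visits_mul_le_sum {E : Set ℕ} {g : ℕ → ℝ} {c : ℝ} (hg : ∀ n, 0 ≤ g n)
    (hE : ∀ n ∈ E, c ≤ g n) (m L : ℕ) :
    visits E m L * c ≤ ∑ n ∈ Finset.Ico m (m + L), g n := by
  classical
  unfold visits
  rw [← nsmul_eq_mul]
  refine (Finset.card_nsmul_le_sum _ g c fun n hn => hE n (Finset.mem_filter.1 hn).2).trans ?_
  exact Finset.sum_le_sum_of_subset_of_nonneg (Finset.filter_subset _ _) fun n _ _ => hg n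

lemma visits_eq_ncard (E : Set ℕ) (N : ℕ) : visits E 0 N = (E ∩ Set.Iio N).ncard := by
  classical
  unfold visits
  rw [← Set.ncard_coe_finset]
  congr 1
  ext n
  simp [and_comm]

lemma lowerDensity_pos_of_visits {E : Set ℕ} {δ : ℝ} (hδ : 0 < δ)
    (h : ∀ᶠ N : ℕ in atTop, δ * N ≤ visits E 0 N) : 0 < lowerDensity E := by
  refine lt_of_lt_of_le hδ (le_liminf_of_le ?_ ?_)
  · refine IsBoundedUnder.isCoboundedUnder_ge ⟨1, ?_⟩
    rw [eventually_map]
    filter_upwards with N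
    rw [← visits_eq_ncard]
    exact div_le_one_of_le₀ (by exact_mod_cast visits_le E 0 N) (Nat.cast_nonneg N)
  · filter_upwards [h, eventually_gt_atTop 0] with N hN hN0
    rw [← visits_eq_ncard, le_div_iff₀ (by exact_mod_cast hN0)]
    exact hN

/-- A set has upper Banach density at most `η`, with a linear error bound: the number of visits in
any window of length `L` is at most `η * L + C`. -/
def BanachDensityLE (E : Set ℕ) (η : ℝ) : Prop :=
  ∃ C : ℝ, ∀ m L : ℕ, (visits E m L : ℝ) ≤ η * L + C

/-- `R` is syndetic with gaps at most `G`. -/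
def IsSyndeticWith (R : Set ℕ) (G : ℕ) : Prop :=
  ∀ m : ℕ, ∃ n ∈ R, m ≤ n ∧ n ≤ m + G

lemma IsSyndeticWith.eventually_le_visits {R : Set ℕ} {G : ℕ} (h : IsSyndeticWith R G) :
    ∃ δ : ℝ, 0 < δ ∧ ∀ᶠ N : ℕ in atTop, δ * N ≤ visits R 0 N := by
  classical
  have key : ∀ q m : ℕ, q ≤ visits R m ((G + 1) * q) := by
    intro q
    induction q with
    | zero => simp
    | succ q ih =>
      intro m
      rw [Nat.mul_succ, visits_append]
      have h1 : 1 ≤ visits R (m + (G + 1) * q) (G + 1) := by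
        obtain ⟨n, hn, h1, h2⟩ := h (m + (G + 1) * q)
        refine Finset.card_pos.2 ⟨n, ?_⟩
        rw [Finset.mem_filter, Finset.mem_Ico]
        exact ⟨⟨h1, by omega⟩, hn⟩
      have := ih m
      omega
  have hG : (0 : ℝ) < 2 * (G + 1) := by positivity
  refine ⟨1 / (2 * (G + 1)), by positivity, ?_⟩
  filter_upwards [eventually_ge_atTop (2 * (G + 1))] with N hN
  have h1 := key (N / (G + 1)) 0
  have h2 : visits R 0 ((G + 1) * (N / (G + 1))) ≤ visits R 0 N := by
    conv_rhs => rw [← Nat.div_add_mod N (G + 1), visits_append]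
    omega
  have h3 : N < (G + 1) * (N / (G + 1)) + (G + 1) := by
    have := Nat.div_add_mod N (G + 1)
    have : N % (G + 1) < G + 1 := Nat.mod_lt N (Nat.succ_pos G)
    omega
  have h4 : ((N / (G + 1) : ℕ) : ℝ) ≤ visits R 0 N := by exact_mod_cast h1.trans h2
  have h5 : (N : ℝ) < (G + 1) * ((N / (G + 1) : ℕ) : ℝ) + (G + 1) := by exact_mod_cast h3
  have h6 : (2 : ℝ) * (G + 1) ≤ N := by exact_mod_cast hN
  rw [div_mul_eq_mul_div, one_mul, div_le_iff₀ hG]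
  nlinarith

/-- A set of small upper Banach density has, along any syndetic set of starting points, a starting
point `s` from which *all* windows contain few of its elements. Otherwise windows with too many
elements, each starting at most `G` after the end of the previous one, could be concatenated to
arbitrarily long windows that still contain too many. -/
lemma IsSyndeticWith.exists_forall_visits_le {R E : Set ℕ} {G : ℕ} {η : ℝ}
    (hR : IsSyndeticWith R G) (hη : 0 < η) (hE : BanachDensityLE E (η / (2 * (G + 1)))) :
    ∃ s ∈ R, ∀ L : ℕ, (visits E s L : ℝ) ≤ η * L := by
  by_contra! hcon
  obtain ⟨C, hC⟩ := hE
  have hG : (0 : ℝ) < G + 1 := by positivity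
  have step : ∀ m : ℕ, ∃ L : ℕ, 1 ≤ L ∧ η / (G + 1) * L ≤ visits E m L := by
    intro m
    obtain ⟨s, hs, hms, hsm⟩ := hR m
    obtain ⟨N, hN⟩ := hcon s hs
    have hN1 : 1 ≤ N := by
      rcases Nat.eq_zero_or_pos N with rfl | h
      · have := visits_le E s 0
        have h0 : visits E s 0 = 0 := by omega
        simp [h0] at hN
      · exact h
    refine ⟨(s - m) + N, by omega, ?_⟩
    rw [visits_append, Nat.add_sub_cancel' hms]
    have h1 : ((s - m + N : ℕ) : ℝ) ≤ (G + 1) * N := by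
      have : s - m + N ≤ (G + 1) * N := by nlinarith [Nat.sub_le_iff_le_add'.2 hsm]
      exact_mod_cast this
    calc η / (G + 1) * ((s - m + N : ℕ) : ℝ) ≤ η / (G + 1) * ((G + 1) * N) := by gcongr
      _ = η * N := by field_simp
      _ ≤ visits E s N := hN.le
      _ ≤ _ := by push_cast; linarith [Nat.cast_nonneg (α := ℝ) (visits E m (s - m))]
  have long : ∀ K : ℕ, ∃ L : ℕ, K ≤ L ∧ η / (G + 1) * L ≤ visits E 0 L := by
    intro K
    induction K with
    | zero => exact ⟨0, le_rfl, by simp⟩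
    | succ K ih =>
      obtain ⟨L, hL, h⟩ := ih
      obtain ⟨L', hL', h'⟩ := step (0 + L)
      refine ⟨L + L', by omega, ?_⟩
      rw [visits_append]
      push_cast
      linarith
  set c := η / (2 * ((G : ℝ) + 1)) with hc
  have hc0 : 0 < c := by positivity
  have hc2 : η / (G + 1) = 2 * c := by rw [hc]; field_simp
  obtain ⟨K, hK⟩ := exists_nat_gt (C / c)
  obtain ⟨L, hL, h⟩ := long K
  have h1 := hC 0 L
  rw [hc2] at h
  rw [div_lt_iff₀ hc0] at hK
  have : (K : ℝ) ≤ L := by exact_mod_cast hL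
  nlinarith

/-! ### Powers of unimodular numbers -/

/-- Orthogonality of the characters `n ↦ z ^ n`: in the mean square over any window of times, the
sum of finitely many of them has norm at most the square root of their number, up to a bounded error. -/
lemma exists_sum_norm_sum_pow_sq_le (s : Finset ℂ) (hs : ∀ z ∈ s, ‖z‖ = 1) :
    ∃ C : ℝ, ∀ m L : ℕ,
      ∑ n ∈ Finset.Ico m (m + L), ‖∑ z ∈ s, z ^ n‖ ^ 2 ≤ s.card * L + C := by
  classical
  let conj := starRingEnd ℂ
  -- The diagonal terms of the constant are `2 / 0 = 0`.
  refine ⟨∑ z ∈ s, ∑ w ∈ s, 2 / ‖z * conj w - 1‖, fun m L => ?_⟩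
  have term : ∀ z ∈ s, ∀ w ∈ s, ‖∑ n ∈ Finset.Ico m (m + L), (z * conj w) ^ n‖ ≤
      (if z = w then (L : ℝ) else 0) + 2 / ‖z * conj w - 1‖ := by
    intro z hz w hw
    have hw1 : conj w * w = 1 := by
      rw [mul_comm, Complex.mul_conj, Complex.normSq_eq_norm_sq, hs w hw]
      simp
    have hn : ‖z * conj w‖ = 1 := by
      rw [norm_mul, hs z hz, one_mul, RCLike.norm_conj, hs w hw]
    split_ifs with h
    · refine (norm_sum_le _ _).trans ?_
      simp only [norm_pow, hn, one_pow, Finset.sum_const, Nat.card_Ico, nsmul_eq_mul, mul_one,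
        Nat.add_sub_cancel_left]
      have : 0 ≤ 2 / ‖z * conj w - 1‖ := by positivity
      linarith
    · have hq : z * conj w ≠ 1 := by
        intro hq
        apply h
        calc z = z * (conj w * w) := by rw [hw1, mul_one]
          _ = z * conj w * w := by ring
          _ = w := by rw [hq, one_mul]
      rw [geom_sum_Ico hq (Nat.le_add_right m L), norm_div, zero_add]
      gcongr
      refine (norm_sub_le _ _).trans ?_
      rw [norm_pow, norm_pow, hn]
      norm_num
  have expand : ((∑ n ∈ Finset.Ico m (m + L), ‖∑ z ∈ s, z ^ n‖ ^ 2 : ℝ) : ℂ) =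
      ∑ z ∈ s, ∑ w ∈ s, ∑ n ∈ Finset.Ico m (m + L), (z * conj w) ^ n := by
    rw [Complex.ofReal_sum]
    have : ∀ n ∈ Finset.Ico m (m + L), ((‖∑ z ∈ s, z ^ n‖ ^ 2 : ℝ) : ℂ) =
        ∑ z ∈ s, ∑ w ∈ s, (z * conj w) ^ n := by
      intro n _
      rw [← Complex.normSq_eq_norm_sq, ← Complex.mul_conj, map_sum, Finset.sum_mul_sum]
      simp only [map_pow, mul_pow, conj]
    rw [Finset.sum_congr rfl this, Finset.sum_comm]
    exact Finset.sum_congr rfl fun z _ => Finset.sum_comm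
  have hnonneg : 0 ≤ ∑ n ∈ Finset.Ico m (m + L), ‖∑ z ∈ s, z ^ n‖ ^ 2 :=
    Finset.sum_nonneg fun n _ => by positivity
  rw [← Complex.norm_of_nonneg hnonneg, expand]
  calc _ ≤ ∑ z ∈ s, ∑ w ∈ s, ((if z = w then (L : ℝ) else 0) + 2 / ‖z * conj w - 1‖) := by
        refine (norm_sum_le _ _).trans (Finset.sum_le_sum fun z hz => ?_)
        exact (norm_sum_le _ _).trans (Finset.sum_le_sum fun w hw => term z hz w hw)
    _ = _ := by
        simp only [Finset.sum_add_distrib]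
        congr 1
        rw [Finset.sum_congr rfl fun z hz => (by simp [hz] :
          (∑ w ∈ s, if z = w then (L : ℝ) else 0) = L)]
        simp

/-- The Bohr set of common `ε`-almost periods of the sequences `n ↦ z ^ n`, `z ∈ F`. -/
def bohrSet (F : Finset ℂ) (ε : ℝ) : Set ℕ :=
  {n | ∀ z ∈ F, ‖z ^ n - 1‖ < ε}

lemma exists_isSyndeticWith_bohrSet (F : Finset ℂ) (hF : ∀ z ∈ F, ‖z‖ = 1) {ε : ℝ} (hε : 0 < ε) :
    ∃ G, IsSyndeticWith (bohrSet F ε) G := by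
  classical
  let a : ℕ → F → ℂ := fun n z => (z : ℂ) ^ n
  have hbdd : TotallyBounded (Set.range a) := by
    refine ((isCompact_closedBall (0 : F → ℂ) 1).totallyBounded).subset ?_
    rintro _ ⟨n, rfl⟩
    rw [mem_closedBall_zero_iff, pi_norm_le_iff_of_nonneg zero_le_one]
    intro z
    simp [a, hF z z.2]
  obtain ⟨t, htsub, htfin, ht⟩ :=
    (totallyBounded_iff_subset.1 hbdd) _ (Metric.dist_mem_uniformity hε)
  have hex : ∀ y ∈ t, ∃ n, a n = y := fun y hy => htsub hy
  choose! k hk using hex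
  obtain ⟨G, hG⟩ := (htfin.image k).bddAbove
  refine ⟨G, fun m => ?_⟩
  -- Among the powers of index at most `G` there is one close to the power of index `m + G`.
  obtain ⟨y, hy, hmy⟩ := Set.mem_iUnion₂.1 (ht (Set.mem_range_self (m + G)))
  have hkG : k y ≤ G := hG (Set.mem_image_of_mem k hy)
  refine ⟨m + G - k y, ?_, by omega, by omega⟩
  intro z hz
  have h1 : dist (a (m + G)) (a (k y)) < ε := by rw [hk y hy]; exact hmy
  have h2 := (dist_pi_lt_iff hε).1 h1 ⟨z, hz⟩
  have h3 : z ^ (m + G) - z ^ k y = z ^ k y * (z ^ (m + G - k y) - 1) := by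
    rw [mul_sub, mul_one, ← pow_add, Nat.add_sub_cancel' (by omega)]
  rw [dist_eq_norm] at h2
  simp only [a] at h2
  rwa [h3, norm_mul, norm_pow, hF z hz, one_pow, one_mul] at h2

/-! ### Combinations of unimodular eigenvectors -/

section Operator

variable {X : Type*} [NormedAddCommGroup X] [NormedSpace ℂ X] (T : X →L[ℂ] X)

/-- The span of the eigenvectors of `T` associated to eigenvalues of modulus `1`. -/
def unimodularSpan : Submodule ℂ X :=
  Submodule.span ℂ {e | ∃ z : ℂ, ‖z‖ = 1 ∧ T e = z • e}

variable {T}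

lemma pow_apply_of_eigenvector {e : X} {z : ℂ} (h : T e = z • e) (n : ℕ) :
    (T ^ n) e = z ^ n • e := by
  induction n with
  | zero => simp
  | succ n ih => rw [pow_succ', mul_apply_eq_comp, ih, map_smul, h, smul_smul, pow_succ]

lemma pow_apply_mem_unimodularSpan {v : X} (hv : v ∈ unimodularSpan T) (n : ℕ) :
    (T ^ n) v ∈ unimodularSpan T := by
  induction hv using Submodule.span_induction with
  | mem e he =>
    obtain ⟨z, hz, h⟩ := he
    rw [pow_apply_of_eigenvector h]
    exact Submodule.smul_mem _ _ (Submodule.subset_span ⟨z, hz, h⟩)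
  | zero => rw [map_zero]; exact Submodule.zero_mem _
  | add x y _ _ hx hy => rw [map_add]; exact Submodule.add_mem _ hx hy
  | smul a x _ hx => rw [map_smul]; exact Submodule.smul_mem _ _ hx

/-- The orbit of a combination of unimodular eigenvectors is controlled by the powers of finitely
many unimodular numbers. -/
lemma exists_norm_pow_sub_pow_le {v : X} (hv : v ∈ unimodularSpan T) :
    ∃ F : Finset ℂ, (∀ z ∈ F, ‖z‖ = 1) ∧ ∃ C : ℝ, 0 < C ∧ ∀ (n m : ℕ) (δ : ℝ), 0 ≤ δ →
      (∀ z ∈ F, ‖z ^ n - z ^ m‖ ≤ δ) → ‖(T ^ n) v - (T ^ m) v‖ ≤ C * δ := by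
  classical
  induction hv using Submodule.span_induction with
  | mem e he =>
    obtain ⟨z, hz, h⟩ := he
    refine ⟨{z}, by simpa using hz, ‖e‖ + 1, by positivity, fun n m δ hδ hF => ?_⟩
    rw [pow_apply_of_eigenvector h, pow_apply_of_eigenvector h, ← sub_smul, norm_smul]
    have := hF z (by simp)
    nlinarith [norm_nonneg e, norm_nonneg (z ^ n - z ^ m)]
  | zero => exact ⟨∅, by simp, 1, one_pos, fun n m δ hδ _ => by simpa using hδ⟩
  | add x y _ _ hx hy =>
    obtain ⟨F, hF, C, hC, h⟩ := hx
    obtain ⟨F', hF', C', hC', h'⟩ := hy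
    refine ⟨F ∪ F', ?_, C + C', by positivity, fun n m δ hδ hz => ?_⟩
    · intro z hz
      rcases Finset.mem_union.1 hz with hz | hz
      exacts [hF z hz, hF' z hz]
    · have h1 := h n m δ hδ fun z hzF => hz z (Finset.mem_union_left _ hzF)
      have h2 := h' n m δ hδ fun z hzF => hz z (Finset.mem_union_right _ hzF)
      rw [map_add, map_add, add_sub_add_comm, add_mul]
      exact (norm_add_le _ _).trans (add_le_add h1 h2)
  | smul a x _ hx =>
    obtain ⟨F, hF, C, hC, h⟩ := hx
    refine ⟨F, hF, (‖a‖ + 1) * C, by positivity, fun n m δ hδ hz => ?_⟩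
    rw [map_smul, map_smul, ← smul_sub, norm_smul]
    have h1 := h n m δ hδ hz
    have : 0 ≤ C * δ := by positivity
    nlinarith [mul_le_mul_of_nonneg_left h1 (norm_nonneg a)]

/-! ### Blocks that are large only rarely -/

variable (T) in
/-- The vectors `y` every neighbourhood of which meets `ker (T - z)` for infinitely many unimodular `z`.
The vector `0` is admitted, and that any other such `y` is an eigenvector itself is not needed. -/
def eigenvectorLimits : Set X :=
  {y | ∀ ε > 0, {z : ℂ | ‖z‖ = 1 ∧ ∃ e, T e = z • e ∧ ‖e - y‖ < ε}.Infinite}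

variable (T) in
/-- The vectors that can be approximated by combinations `b` of unimodular eigenvectors such that
`T ^ n b` is small for all times `n` outside a set of small upper Banach density. -/
def IsBlockLimit (v : X) : Prop :=
  ∀ ε > 0, ∀ η > 0, ∃ b ∈ unimodularSpan T,
    ‖b - v‖ < ε ∧ BanachDensityLE {n | ε ≤ ‖(T ^ n) b‖} η

lemma isBlockLimit_of_mem_eigenvectorLimits {y : X} (hy : y ∈ eigenvectorLimits T) :
    IsBlockLimit T y := by
  classical
  intro ε hε η hη
  -- If the orbit of the average is at least `ε`, the average of the powers is at least `τ`.
  set τ : ℝ := ε / (2 * (‖y‖ + 1)) with hτ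
  have hτ0 : 0 < τ := by positivity
  obtain ⟨N, hN⟩ := exists_nat_gt (1 / (η * τ ^ 2))
  have hN0 : (0 : ℝ) < N := lt_trans (by positivity) hN
  obtain ⟨s, hs, hcard⟩ := (hy (ε / 2) (half_pos hε)).exists_subset_card_eq N
  have hs1 : ∀ z ∈ s, ‖z‖ = 1 := fun z hz => (hs hz).1
  have hs2 : ∀ z ∈ s, ∃ e, T e = z • e ∧ ‖e - y‖ < ε / 2 := fun z hz => (hs hz).2
  choose! e he hey using hs2
  have hpow : ∀ n, (T ^ n) ((N : ℂ)⁻¹ • ∑ z ∈ s, e z) = (N : ℂ)⁻¹ • ∑ z ∈ s, z ^ n • e z := by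
    intro n
    rw [map_smul, map_sum]
    congr 1
    exact Finset.sum_congr rfl fun z hz => pow_apply_of_eigenvector (he z hz) n
  have hdev : ∀ n, ‖(T ^ n) ((N : ℂ)⁻¹ • ∑ z ∈ s, e z) - ((N : ℂ)⁻¹ * ∑ z ∈ s, z ^ n) • y‖
      ≤ ε / 2 := by
    intro n
    rw [hpow, mul_smul, ← smul_sub, Finset.sum_smul, ← Finset.sum_sub_distrib, norm_smul, norm_inv,
      Complex.norm_natCast, inv_mul_le_iff₀ hN0]
    calc ‖∑ z ∈ s, (z ^ n • e z - z ^ n • y)‖ ≤ ∑ z ∈ s, ε / 2 := by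
          refine (norm_sum_le _ _).trans (Finset.sum_le_sum fun z hz => ?_)
          rw [← smul_sub, norm_smul, norm_pow, hs1 z hz, one_pow, one_mul]
          exact (hey z hz).le
      _ = N * (ε / 2) := by rw [Finset.sum_const, hcard, nsmul_eq_mul]
  refine ⟨(N : ℂ)⁻¹ • ∑ z ∈ s, e z, ?_, ?_, ?_⟩
  · exact Submodule.smul_mem _ _ (Submodule.sum_mem _ fun z hz =>
      Submodule.subset_span ⟨z, hs1 z hz, he z hz⟩)
  · have h0 := hdev 0
    have hNC : (N : ℂ) ≠ 0 := by
      intro h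
      rw [Nat.cast_eq_zero] at h
      simp [h] at hN0
    simp only [pow_zero, one_apply_eq_self, Finset.sum_const, hcard, nsmul_eq_mul,
      mul_one, inv_mul_cancel₀ hNC, one_smul] at h0
    linarith
  · obtain ⟨C, hC⟩ := exists_sum_norm_sum_pow_sq_le s hs1
    refine ⟨C / (N * τ) ^ 2, fun m L => ?_⟩
    have hbad : ∀ n ∈ {n | ε ≤ ‖(T ^ n) ((N : ℂ)⁻¹ • ∑ z ∈ s, e z)‖},
        (N * τ) ^ 2 ≤ ‖∑ z ∈ s, z ^ n‖ ^ 2 := by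
      intro n hn
      have h1 := hdev n
      have h2 : ε / 2 ≤ ‖((N : ℂ)⁻¹ * ∑ z ∈ s, z ^ n) • y‖ := by
        have h3 := norm_sub_norm_le ((T ^ n) ((N : ℂ)⁻¹ • ∑ z ∈ s, e z))
          (((N : ℂ)⁻¹ * ∑ z ∈ s, z ^ n) • y)
        rw [Set.mem_ofPred_eq] at hn
        linarith
      rw [norm_smul, norm_mul, norm_inv, Complex.norm_natCast] at h2
      have h4 : ε / 2 = τ * (‖y‖ + 1) := by rw [hτ]; field_simp
      have h5 : τ * (‖y‖ + 1) ≤ (N : ℝ)⁻¹ * ‖∑ z ∈ s, z ^ n‖ * (‖y‖ + 1) := by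
        rw [← h4]
        refine h2.trans ?_
        gcongr
        linarith
      have h6 : τ ≤ (N : ℝ)⁻¹ * ‖∑ z ∈ s, z ^ n‖ := le_of_mul_le_mul_right h5 (by positivity)
      rw [le_inv_mul_iff₀ hN0] at h6
      exact pow_le_pow_left₀ (by positivity) h6 2
    have h1 := (visits_mul_le_sum (fun n => by positivity) hbad m L).trans (hC m L)
    rw [hcard] at h1
    have hpos : (0 : ℝ) < (N * τ) ^ 2 := by positivity
    rw [← le_div_iff₀ hpos, add_div] at h1
    refine h1.trans (add_le_add_left ?_ _)
    rw [div_le_iff₀ hpos]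
    rw [div_lt_iff₀ (by positivity)] at hN
    have hL : (0 : ℝ) ≤ L := Nat.cast_nonneg L
    nlinarith [mul_nonneg (mul_nonneg hN0.le hL) (sub_nonneg.2 hN.le)]

lemma BanachDensityLE.mono {E F : Set ℕ} {η : ℝ} (hF : BanachDensityLE F η) (h : E ⊆ F) :
    BanachDensityLE E η := by
  obtain ⟨C, hC⟩ := hF
  exact ⟨C, fun m L => le_trans (by exact_mod_cast visits_mono h m L) (hC m L)⟩

lemma BanachDensityLE.union {E F : Set ℕ} {η θ : ℝ} (hE : BanachDensityLE E η)
    (hF : BanachDensityLE F θ) : BanachDensityLE (E ∪ F) (η + θ) := by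
  obtain ⟨C, hC⟩ := hE
  obtain ⟨D, hD⟩ := hF
  refine ⟨C + D, fun m L => ?_⟩
  have h : (visits (E ∪ F) m L : ℝ) ≤ visits E m L + visits F m L := by
    exact_mod_cast visits_union_le E F m L
  linarith [hC m L, hD m L]

lemma IsBlockLimit.add {v w : X} (hv : IsBlockLimit T v) (hw : IsBlockLimit T w) :
    IsBlockLimit T (v + w) := by
  intro ε hε η hη
  obtain ⟨b, hb, hbv, hbE⟩ := hv (ε / 2) (half_pos hε) (η / 2) (half_pos hη)
  obtain ⟨c, hc, hcw, hcE⟩ := hw (ε / 2) (half_pos hε) (η / 2) (half_pos hη)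
  refine ⟨b + c, Submodule.add_mem _ hb hc, ?_, ?_⟩
  · rw [add_sub_add_comm]
    exact (norm_add_le _ _).trans_lt (by linarith)
  · rw [← add_halves η]
    refine (hbE.union hcE).mono fun n hn => ?_
    by_contra h
    simp only [Set.mem_union, Set.mem_ofPred_eq, not_or, not_le] at h hn
    rw [map_add] at hn
    linarith [norm_add_le ((T ^ n) b) ((T ^ n) c)]

lemma IsBlockLimit.smul {v : X} (hv : IsBlockLimit T v) (a : ℂ) : IsBlockLimit T (a • v) := by
  intro ε hε η hη
  have ha : 0 < ‖a‖ + 1 := by positivity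
  obtain ⟨b, hb, hbv, hbE⟩ := hv (ε / (‖a‖ + 1)) (by positivity) η hη
  have key : ∀ x : X, ‖x‖ < ε / (‖a‖ + 1) → ‖a • x‖ < ε := by
    intro x hx
    rw [lt_div_iff₀ ha] at hx
    rw [norm_smul]
    nlinarith [norm_nonneg x]
  refine ⟨a • b, Submodule.smul_mem _ _ hb, ?_, hbE.mono fun n hn => ?_⟩
  · rw [← smul_sub]
    exact key _ hbv
  · by_contra h
    rw [Set.mem_ofPred_eq] at h hn
    rw [map_smul] at hn
    exact absurd (key _ (not_le.1 h)) (not_lt.2 hn)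

lemma isBlockLimit_of_dense (h : Dense (Submodule.span ℂ (eigenvectorLimits T) : Set X)) (v : X) :
    IsBlockLimit T v := by
  have hspan : ∀ w ∈ Submodule.span ℂ (eigenvectorLimits T), IsBlockLimit T w := by
    intro w hw
    induction hw using Submodule.span_induction with
    | mem y hy => exact isBlockLimit_of_mem_eigenvectorLimits hy
    | zero =>
      intro ε hε η hη
      refine ⟨0, Submodule.zero_mem _, by simpa using hε, 0, fun m L => ?_⟩
      have : {n : ℕ | ε ≤ ‖(T ^ n) (0 : X)‖} = ∅ := by
        ext n
        simpa using hε
      rw [this]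
      simp only [visits, Set.mem_empty_iff_false, Finset.filter_false, Finset.card_empty,
        Nat.cast_zero, add_zero]
      positivity
    | add x y _ _ hx hy => exact hx.add hy
    | smul a x _ hx => exact hx.smul a
  intro ε hε η hη
  obtain ⟨w, hw, hwv⟩ := Metric.dense_iff.1 h v (ε / 2) (half_pos hε)
  obtain ⟨b, hb, hbw, hbE⟩ := hspan w hwv (ε / 2) (half_pos hε) η hη
  refine ⟨b, hb, ?_, hbE.mono fun n hn => ?_⟩
  · rw [Metric.mem_ball, dist_eq_norm] at hw
    calc ‖b - v‖ = ‖(b - w) + (w - v)‖ := by rw [sub_add_sub_cancel]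
      _ < ε := (norm_add_le _ _).trans_lt (by linarith)
  · rw [Set.mem_ofPred_eq] at hn ⊢
    linarith

/-- Outside countably many eigenvalues every unimodular eigenvector is a limit of eigenvectors for
other eigenvalues: the members of a countable basis which meet only countably many eigenspaces
exclude only countably many eigenvalues. -/
lemma dense_span_eigenvectorLimits [TopologicalSpace.SeparableSpace X]
    (hT : HasPerfectlySpanningUnimodularEigenvectors T) :
    Dense (Submodule.span ℂ (eigenvectorLimits T) : Set X) := by
  obtain ⟨σ, hσ, hσ0, hspan⟩ := hT
  have : SecondCountableTopology X := UniformSpace.secondCountable_of_separable X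
  let Λ : Set X → Set (Metric.sphere (0 : ℂ) 1) := fun U => {z | ∃ e ∈ U, T e = (z : ℂ) • e}
  let 𝓑 := TopologicalSpace.countableBasis X
  let Z : Set (Metric.sphere (0 : ℂ) 1) := ⋃ U ∈ {U ∈ 𝓑 | (Λ U).Countable}, Λ U
  have hZ : Z.Countable :=
    ((TopologicalSpace.countable_countableBasis X).mono (Set.sep_subset _ _)).biUnion
      fun U hU => hU.2
  have hmeas : MeasurableSet Zᶜ := hZ.measurableSet.compl
  have hone : σ Zᶜ = 1 := (prob_compl_eq_one_iff hZ.measurableSet).2 (hZ.measure_zero σ)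
  refine (hspan Zᶜ hmeas.nullMeasurableSet hone).mono (Submodule.span_mono ?_)
  intro e he
  simp only [Set.mem_iUnion] at he
  obtain ⟨z, hz, he⟩ := he
  have hez : T e = (z : ℂ) • e := Module.End.mem_eigenspace_iff.1 he
  intro ε hε
  obtain ⟨U, hU, heU, hUε⟩ := (TopologicalSpace.isBasis_countableBasis X).exists_subset_of_mem_open
    (Metric.mem_ball_self hε) (Metric.isOpen_ball (x := e))
  have hunc : ¬ (Λ U).Countable := fun hc =>
    hz (Set.mem_biUnion (show U ∈ {U ∈ 𝓑 | (Λ U).Countable} from ⟨hU, hc⟩) ⟨e, heU, hez⟩)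
  have hinf : (Λ U).Infinite := fun hf => hunc hf.countable
  refine (hinf.image Subtype.val_injective.injOn).mono ?_
  rintro _ ⟨w, ⟨f, hf, hfw⟩, rfl⟩
  refine ⟨by simp, f, hfw, ?_⟩
  rw [← dist_eq_norm]
  exact hUε hf

/-- Every vector is approximated by combinations of unimodular eigenvectors whose orbit is small
except at a set of times of small upper Banach density. -/
lemma exists_block [TopologicalSpace.SeparableSpace X]
    (hT : HasPerfectlySpanningUnimodularEigenvectors T) (v : X) {ε η : ℝ} (hε : 0 < ε)
    (hη : 0 < η) : ∃ b ∈ unimodularSpan T,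
      ‖b - v‖ < ε ∧ BanachDensityLE {n | ε ≤ ‖(T ^ n) b‖} η :=
  isBlockLimit_of_dense (dense_span_eigenvectorLimits hT) v ε hε η hη

/-! ### Adding a block -/

/-- A combination `v` of unimodular eigenvectors can be changed by some `w`, so that the orbit of
`v + w` visits the `ε`-ball around `u` with positive frequency, while the orbit of `w` is at least
`ε` only for a proportion `η` of the times in each initial segment. -/
lemma exists_next_block [TopologicalSpace.SeparableSpace X]
    (hT : HasPerfectlySpanningUnimodularEigenvectors T) {v : X} (hv : v ∈ unimodularSpan T) (u : X)
    {ε η : ℝ} (hε : 0 < ε) (hη : 0 < η) :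
    ∃ w ∈ unimodularSpan T, (∀ N : ℕ, (visits {n | ε ≤ ‖(T ^ n) w‖} 0 N : ℝ) ≤ η * N) ∧
      ∃ δ : ℝ, 0 < δ ∧
        ∀ᶠ N : ℕ in atTop, δ * N ≤ visits {n | ‖(T ^ n) (v + w) - u‖ < ε} 0 N := by
  classical
  obtain ⟨F, hF, C, hC, hvF⟩ := exists_norm_pow_sub_pow_le hv
  obtain ⟨G, hG⟩ := exists_isSyndeticWith_bohrSet F hF (ε := ε / (8 * C)) (by positivity)
  obtain ⟨b, hb, hbu, hbE⟩ := exists_block hT (u - v) (ε := ε / 4)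
    (η := η / (2 * (G + 1))) (by positivity) (by positivity)
  obtain ⟨s, hs, hsE⟩ := hG.exists_forall_visits_le hη hbE
  obtain ⟨F', hF', C', hC', hbF⟩ := exists_norm_pow_sub_pow_le hb
  refine ⟨(T ^ s) b, pow_apply_mem_unimodularSpan hb s, fun N => ?_, ?_⟩
  · refine le_trans ?_ (hsE N)
    rw [← visits_preimage_add _ s]
    refine Nat.cast_le.2 (visits_mono (fun n hn => ?_) 0 N)
    rw [Set.mem_ofPred_eq, ← mul_apply_eq_comp, ← pow_add] at hn
    rw [Set.mem_ofPred_eq, Set.mem_ofPred_eq]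
    linarith
  -- The common almost periods of `v` and `b`, shifted by `-s`, are visits of `v + T ^ s b`.
  obtain ⟨G', hG'⟩ := exists_isSyndeticWith_bohrSet (F ∪ F')
    (fun z hz => (Finset.mem_union.1 hz).elim (hF z) (hF' z))
    (ε := min (ε / (8 * C)) (ε / (4 * C'))) (by positivity)
  have hsyn : IsSyndeticWith {n | ‖(T ^ n) (v + (T ^ s) b) - u‖ < ε} G' := by
    intro a
    obtain ⟨m, hm, h1, h2⟩ := hG' (a + s)
    obtain ⟨n, rfl⟩ : ∃ n, m = n + s := ⟨m - s, by omega⟩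
    refine ⟨n, ?_, by omega, by omega⟩
    have hvn : ‖(T ^ n) v - (T ^ 0) v‖ ≤ C * (ε / (4 * C)) := by
      refine hvF n 0 _ (by positivity) fun z hz => ?_
      have hz1 := (hm z (Finset.mem_union_left _ hz)).le.trans (min_le_left _ _)
      have hz2 := (hs z hz).le
      have : ‖z ^ n - z ^ 0‖ = ‖(z ^ (n + s) - 1) - (z ^ s - 1)‖ := by
        rw [show (z ^ (n + s) - 1) - (z ^ s - 1) = (z ^ n - z ^ 0) * z ^ s by
          rw [pow_add, pow_zero]; ring, norm_mul, norm_pow, hF z hz, one_pow, mul_one]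
      rw [this]
      refine (norm_sub_le _ _).trans ((add_le_add hz1 hz2).trans (le_of_eq ?_))
      field_simp
      norm_num
    have hbn : ‖(T ^ (n + s)) b - (T ^ 0) b‖ ≤ C' * (ε / (4 * C')) := by
      refine hbF (n + s) 0 _ (by positivity) fun z hz => ?_
      rw [pow_zero]
      exact (hm z (Finset.mem_union_right _ hz)).le.trans (min_le_right _ _)
    rw [show C * (ε / (4 * C)) = ε / 4 by field_simp, pow_zero,
      one_apply_eq_self] at hvn
    rw [show C' * (ε / (4 * C')) = ε / 4 by field_simp, pow_zero,
      one_apply_eq_self] at hbn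
    rw [Set.mem_ofPred_eq, map_add, ← mul_apply_eq_comp, ← pow_add,
      show (T ^ n) v + (T ^ (n + s)) b - u
        = ((T ^ n) v - v) + ((T ^ (n + s)) b - b) + (b - (u - v)) by abel]
    exact (norm_add₃_le).trans_lt (by linarith)
  exact hsyn.eventually_le_visits

/-! ### The series -/

/-- Infinitely many exceptional sets `E l`, of proportions at most `θ * (1 / 4) ^ l` in all initial
segments, account for a proportion of at most `4 / 3 * θ`. -/
lemma visits_le_of_subset_union_iUnion {A B : Set ℕ} {E : ℕ → Set ℕ} {θ : ℝ} (hθ : 0 ≤ θ)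
    (hAB : A ⊆ B ∪ ⋃ l, E l)
    (hE : ∀ l N : ℕ, (visits (E l) 0 N : ℝ) ≤ θ * (1 / 4) ^ l * N) (N : ℕ) :
    (visits A 0 N : ℝ) ≤ visits B 0 N + 4 / 3 * θ * N := by
  classical
  -- Only finitely many of the sets meet `[0, N)`.
  have htend : Tendsto (fun l : ℕ => θ * (1 / 4 : ℝ) ^ l * N) atTop (𝓝 0) := by
    have := (tendsto_pow_atTop_nhds_zero_of_lt_one (r := (1 / 4 : ℝ)) (by norm_num)
      (by norm_num)).const_mul θ |>.mul_const (N : ℝ)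
    simpa using this
  obtain ⟨M, hM⟩ := eventually_atTop.1 (htend.eventually (gt_mem_nhds one_pos))
  have hsub : (Finset.Ico 0 (0 + N)).filter (· ∈ A) ⊆
      (Finset.Ico 0 (0 + N)).filter (· ∈ B) ∪
        (Finset.range M).biUnion fun l => (Finset.Ico 0 (0 + N)).filter (· ∈ E l) := by
    intro n hn
    rw [Finset.mem_filter] at hn
    rcases hAB hn.2 with hB | h
    · exact Finset.mem_union_left _ (Finset.mem_filter.2 ⟨hn.1, hB⟩)
    · obtain ⟨l, hl⟩ := Set.mem_iUnion.1 h
      have hnl : n ∈ (Finset.Ico 0 (0 + N)).filter (· ∈ E l) := Finset.mem_filter.2 ⟨hn.1, hl⟩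
      refine Finset.mem_union_right _ (Finset.mem_biUnion.2 ⟨l, ?_, hnl⟩)
      by_contra hlM
      have h1 : 1 ≤ visits (E l) 0 N := Finset.card_pos.2 ⟨n, hnl⟩
      have h2 := hE l N
      have h3 := hM l (by simpa using hlM)
      have h4 : (1 : ℝ) ≤ visits (E l) 0 N := by exact_mod_cast h1
      linarith
  have hcard : visits A 0 N ≤ visits B 0 N + ∑ l ∈ Finset.range M, visits (E l) 0 N :=
    (Finset.card_le_card hsub).trans
      ((Finset.card_union_le _ _).trans (Nat.add_le_add le_rfl Finset.card_biUnion_le))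
  have hsum : (∑ l ∈ Finset.range M, (visits (E l) 0 N : ℝ)) ≤ 4 / 3 * θ * N := by
    calc (∑ l ∈ Finset.range M, (visits (E l) 0 N : ℝ))
        ≤ ∑ l ∈ Finset.range M, θ * (1 / 4 : ℝ) ^ l * N := Finset.sum_le_sum fun l _ => hE l N
      _ = (∑ l ∈ Finset.range M, (1 / 4 : ℝ) ^ l) * (θ * N) := by
          rw [Finset.sum_mul]
          exact Finset.sum_congr rfl fun l _ => by ring
      _ ≤ (4 / 3) * (θ * N) := by
          gcongr
          have h := (summable_geometric_of_lt_one (r := (1 / 4 : ℝ)) (by norm_num)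
            (by norm_num)).sum_le_tsum (Finset.range M) fun l _ => by positivity
          rw [tsum_geometric_of_lt_one (by norm_num) (by norm_num)] at h
          norm_num at h ⊢
          exact h
      _ = _ := by ring
  have : (visits A 0 N : ℝ) ≤
      visits B 0 N + ∑ l ∈ Finset.range M, (visits (E l) 0 N : ℝ) := by
    exact_mod_cast hcard
  linarith

/-- The iteration of `exists_next_block`: the `k`-th partial sum visits the target `u k` with
frequency `δ k`, and the proportions `θ l` of exceptional times of the later blocks decrease so fast
that their sum is small compared with `δ k`. -/
lemma exists_blocks [TopologicalSpace.SeparableSpace X]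
    (hT : HasPerfectlySpanningUnimodularEigenvectors T) (u : ℕ → X) :
    ∃ (w : ℕ → X) (θ δ : ℕ → ℝ),
      (∀ k, 0 < δ k ∧ θ (k + 1) ≤ δ k / 4) ∧
      (∀ k, 0 < θ k ∧ θ k < 1 ∧ θ (k + 1) ≤ θ k / 4) ∧
      (∀ k (N : ℕ), (visits {n | (1 / 2 : ℝ) ^ k ≤ ‖(T ^ n) (w k)‖} 0 N : ℝ) ≤ θ k * N) ∧
      (∀ k, ∀ᶠ N : ℕ in atTop, δ k * N ≤
        visits {n | ‖(T ^ n) (∑ i ∈ Finset.range (k + 1), w i) - u k‖ < (1 / 2) ^ k} 0 N) := by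
  have hstep : ∀ (k : ℕ) (p : unimodularSpan T × {η : ℝ // 0 < η}), ∃ (w : unimodularSpan T)
      (δ : {δ : ℝ // 0 < δ}),
      (∀ N : ℕ, (visits {n | (1 / 2 : ℝ) ^ k ≤ ‖(T ^ n) (w : X)‖} 0 N : ℝ) ≤ p.2 * N) ∧
      ∀ᶠ N : ℕ in atTop,
        (δ : ℝ) * N ≤ visits {n | ‖(T ^ n) ((p.1 : X) + w) - u k‖ < (1 / 2) ^ k} 0 N := by
    rintro k ⟨⟨v, hv⟩, η, hη⟩
    obtain ⟨w, hw, h1, δ, hδ, h2⟩ := exists_next_block hT hv (u k) (ε := (1 / 2) ^ k)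
      (by positivity) hη
    exact ⟨⟨w, hw⟩, ⟨δ, hδ⟩, h1, h2⟩
  choose W D hW hD using hstep
  -- The state after `k` steps: the partial sum, and the proportion allowed to the next block.
  let st : ℕ → unimodularSpan T × {η : ℝ // 0 < η} := fun k =>
    Nat.rec (0, ⟨1 / 2, by norm_num⟩) (fun k p => (p.1 + W k p,
      ⟨min (p.2 : ℝ) (D k p) / 4, div_pos (lt_min p.2.2 (D k p).2) (by norm_num)⟩)) k
  have hst : ∀ k, st (k + 1) = ((st k).1 + W k (st k),
      ⟨min ((st k).2 : ℝ) (D k (st k)) / 4,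
        div_pos (lt_min (st k).2.2 (D k (st k)).2) (by norm_num)⟩) := fun k => rfl
  have hθ : ∀ k, ((st (k + 1)).2 : ℝ) = min ((st k).2 : ℝ) (D k (st k)) / 4 := fun k => by rw [hst]
  have hsum : ∀ k, ((st k).1 : X) = ∑ i ∈ Finset.range k, (W i (st i) : X) := by
    intro k
    induction k with
    | zero => rfl
    | succ k ih => rw [Finset.sum_range_succ, ← ih, hst]; rfl
  have hdec : ∀ k, ((st (k + 1)).2 : ℝ) ≤ (st k).2 / 4 := fun k => by
    rw [hθ]
    gcongr
    exact min_le_left _ _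
  refine ⟨fun k => W k (st k), fun k => (st k).2, fun k => D k (st k), fun k => ⟨(D k (st k)).2, ?_⟩,
    fun k => ⟨(st k).2.2, ?_, hdec k⟩, fun k N => hW k (st k) N, fun k => ?_⟩
  · refine (hθ k).le.trans ?_
    gcongr
    exact min_le_right _ _
  · induction k with
    | zero => change (1 / 2 : ℝ) < 1; norm_num
    | succ k ih => linarith [hdec k, (st k).2.2]
  · have := hD k (st k)
    simp only [hsum] at this
    simpa only [Finset.sum_range_succ] using this

end Operator

theorem theorem1p3 {X : Type*} [NormedAddCommGroup X] [NormedSpace ℂ X] [CompleteSpace X]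
    [TopologicalSpace.SeparableSpace X] (T : X →L[ℂ] X)
    (hT : HasPerfectlySpanningUnimodularEigenvectors T) :
    IsFrequentlyHypercyclic T := by
  -- Each member of the dense sequence is the target at infinitely many steps.
  obtain ⟨w, θ, δ, hδ, hθ, hw, hvis⟩ := exists_blocks hT
    fun k => TopologicalSpace.denseSeq X (Nat.unpair k).1
  have hgeom : Summable fun k : ℕ => (1 / 2 : ℝ) ^ k := summable_geometric_two
  -- At time `0` no block is exceptional, because its proportion in `[0, 1)` is less than `1`.
  have hw0 : ∀ k, ‖w k‖ ≤ (1 / 2) ^ k := by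
    classical
    intro k
    by_contra! hlt
    have h1 := hw k 1
    have h2 : 1 ≤ visits {n | (1 / 2 : ℝ) ^ k ≤ ‖(T ^ n) (w k)‖} 0 1 := by
      refine Finset.card_pos.2 ⟨0, Finset.mem_filter.2 ⟨by simp, ?_⟩⟩
      simpa using hlt.le
    have h3 : (1 : ℝ) ≤ visits {n | (1 / 2 : ℝ) ^ k ≤ ‖(T ^ n) (w k)‖} 0 1 := by exact_mod_cast h2
    have h4 := (hθ k).2.1
    rw [Nat.cast_one, mul_one] at h1
    linarith
  have hsummable : Summable w := Summable.of_norm_bounded hgeom hw0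
  refine ⟨∑' k, w k, fun U hU hUne => ?_⟩
  obtain ⟨i, hyU⟩ := (TopologicalSpace.denseRange_denseSeq X).exists_mem_open hU hUne
  obtain ⟨r, hr, hrU⟩ := Metric.isOpen_iff.1 hU _ hyU
  obtain ⟨j, hj⟩ := exists_pow_lt_of_lt_one (half_pos hr) (by norm_num : (1 / 2 : ℝ) < 1)
  set k := Nat.pair i j with hk
  have hkr : (1 / 2 : ℝ) ^ k < r / 2 :=
    (pow_le_pow_of_le_one (by norm_num) (by norm_num) (Nat.right_le_pair i j)).trans_lt hj
  have hvk := hvis k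
  rw [hk, Nat.unpair_pair, ← hk] at hvk
  set y := TopologicalSpace.denseSeq X i
  set A : Set ℕ := {n | ‖(T ^ n) (∑ i ∈ Finset.range (k + 1), w i) - y‖ < (1 / 2) ^ k}
  let E : ℕ → Set ℕ := fun l => {n | (1 / 2 : ℝ) ^ (l + (k + 1)) ≤ ‖(T ^ n) (w (l + (k + 1)))‖}
  have hEθ : ∀ l N : ℕ, (visits (E l) 0 N : ℝ) ≤ θ (k + 1) * (1 / 4) ^ l * N := by
    intro l N
    refine (hw (l + (k + 1)) N).trans ?_
    gcongr
    induction l with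
    | zero => simp
    | succ l ih =>
      have := (hθ (l + (k + 1))).2.2
      rw [show l + 1 + (k + 1) = l + (k + 1) + 1 by ring, pow_succ]
      linarith
  have hAE : A ⊆ {n | (T ^ n) (∑' k, w k) ∈ U} ∪ ⋃ l, E l := by
    intro n hnA
    by_cases hnE : n ∈ ⋃ l, E l
    · exact Or.inr hnE
    refine Or.inl (hrU ?_)
    have hnl : ∀ l, ‖(T ^ n) (w (l + (k + 1)))‖ ≤ (1 / 2 : ℝ) ^ (l + (k + 1)) := fun l => by
      by_contra! h
      exact hnE (Set.mem_iUnion.2 ⟨l, h.le⟩)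
    have htail : ‖∑' l, (T ^ n) (w (l + (k + 1)))‖ ≤ (1 / 2) ^ k := by
      refine tsum_of_norm_bounded ?_ hnl
      have h := hasSum_geometric_two.mul_right ((1 / 2 : ℝ) ^ (k + 1))
      simp only [← pow_add] at h
      rwa [show (2 : ℝ) * (1 / 2) ^ (k + 1) = (1 / 2) ^ k by rw [pow_succ]; ring] at h
    rw [Metric.mem_ball, dist_eq_norm, ← hsummable.sum_add_tsum_nat_add (k + 1), map_add,
      (T ^ n).map_tsum ((summable_nat_add_iff (k + 1)).2 hsummable), add_sub_right_comm]
    have hnA' : ‖(T ^ n) (∑ i ∈ Finset.range (k + 1), w i) - y‖ < (1 / 2) ^ k := hnA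
    exact (norm_add_le _ _).trans_lt (by linarith)
  refine lowerDensity_pos_of_visits (δ := δ k / 2) (half_pos (hδ k).1) ?_
  filter_upwards [hvk] with N hN
  have h1 := visits_le_of_subset_union_iUnion (hθ (k + 1)).1.le hAE hEθ N
  have h2 : 4 / 3 * θ (k + 1) * N ≤ δ k / 2 * N := by
    have := hδ k
    gcongr
    linarith
  linarith
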